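/- All graphs are finite, simple and undirected, and classes of graphs are closed under isomorphism. A class is hereditary (monotone) if it is closed under taking induced subgraphs (all subgraphs). A hereditary class $\mathcal C$ is tiny if there is a constant $\gamma$ such that, for every $n\in\mathbb N$, $\mathcal C$ contains at most $\gamma^n$ graphs on $n$ vertices up to isomorphism; it is small if there is a constant $\gamma$ such that, for every $n\in\mathbb N$, $\mathcal C$ contains at most $n!\,\gamma^n$ labeled graphs on the vertex set $\{1,\dots,n\}$. For $c>0$, a hereditary class is $c$-factorial if, for all sufficiently large $n$ (with a threshold that may depend on the class), it contains at most $n^{cn}$ labeled graphs on $\{1,\dots,n\}$. A graph parameter is an isomorphism-invariant function $\sigma$ from graphs to $\mathbb R$; it is bounded on a class $\mathcal C$ if there is $\kappa\in\mathbb N$ with $\sigma(G)\le\kappa$ for all $G\in\mathcal C$, and unbounded on $\mathcal C$ otherwise. It is $c$-factorial if for every $\kappa\in\mathbb N$ the class $\{G:\sigma(G)\le\kappa\}$ is (hereditary and) $c$-factorial, and $\sigma$ is unbounded on every hereditary class that is not $c$-factorial. A set $\Sigma$ of graph parameters describes a family of graph classes if for every class in the family some $\sigma\in\Sigma$ is bounded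 on it. Let $c>0$ and let $\Sigma$ be a countable set of $c$-factorial graph parameters. Then there is a monotone tiny class of graphs on which every parameter in $\Sigma$ is unbounded. Hence $\Sigma$ describes neither the family of all monotone tiny classes nor the family of all small classes. -/

import Mathlib

namespace TinyClasses

/-- Finite simple graphs. Every finite graph is isomorphic to one on some vertex set `Fin n`, so
for isomorphism-invariant notions nothing is lost by using only these vertex sets. -/
abbrev FinGraph : Type := Σ n : ℕ, SimpleGraph (Fin n)

/-- A class of finite graphs, closed under isomorphism. -/
structure GraphClass where
  carrier : Set FinGraph
  iso_closed : ∀ G H : FinGraph, Nonempty (G.2 ≃g H.2) → G ∈ carrier → H ∈ carrier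

/-- Closed under taking induced subgraphs: `H.2 ↪g G.2` says that `H` is isomorphic to an induced
subgraph of `G`. -/
def GraphClass.Hereditary (C : GraphClass) : Prop :=
  ∀ G ∈ C.carrier, ∀ H : FinGraph, Nonempty (H.2 ↪g G.2) → H ∈ C.carrier

/-- Closed under taking subgraphs: `H.2.IsContained G.2` says that `H` is isomorphic to a (not
necessarily induced) subgraph of `G`. -/
def GraphClass.IsMonotone (C : GraphClass) : Prop :=
  ∀ G ∈ C.carrier, ∀ H : FinGraph, H.2.IsContained G.2 → H ∈ C.carrier

/-- The labeled `n`-vertex graphs of the class. -/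
def GraphClass.level (C : GraphClass) (n : ℕ) : Set (SimpleGraph (Fin n)) :=
  {G | (⟨n, G⟩ : FinGraph) ∈ C.carrier}

/-- The number of labeled `n`-vertex graphs in the class. -/
noncomputable def GraphClass.labeledCount (C : GraphClass) (n : ℕ) : ℕ :=
  (C.level n).ncard

/-- Isomorphism of graphs on `n` labeled vertices. -/
def isoSetoid (n : ℕ) : Setoid (SimpleGraph (Fin n)) where
  r G H := Nonempty (G ≃g H)
  iseqv :=
    { refl := fun _ => ⟨RelIso.refl _⟩
      symm := fun ⟨e⟩ => ⟨e.symm⟩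
      trans := fun ⟨e⟩ ⟨f⟩ => ⟨e.trans f⟩ }

/-- The number of unlabeled `n`-vertex graphs (isomorphism classes) in the class. -/
noncomputable def GraphClass.unlabeledCount (C : GraphClass) (n : ℕ) : ℕ :=
  (Quotient.mk (isoSetoid n) '' C.level n).ncard

def GraphClass.IsTiny (C : GraphClass) : Prop :=
  C.Hereditary ∧ ∃ c : ℝ, ∀ n : ℕ, (C.unlabeledCount n : ℝ) ≤ c ^ n

def GraphClass.IsSmall (C : GraphClass) : Prop :=
  C.Hereditary ∧ ∃ c : ℝ, ∀ n : ℕ, (C.labeledCount n : ℝ) ≤ (n.factorial : ℝ) * c ^ n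

/-- A `c`-factorial class. The bound is asked for all sufficiently large `n`, with a threshold
that may depend on the class. -/
def GraphClass.IsFactorial (c : ℝ) (C : GraphClass) : Prop :=
  C.Hereditary ∧
    ∀ᶠ n : ℕ in Filter.atTop, (C.labeledCount n : ℝ) ≤ (n : ℝ) ^ (c * (n : ℝ))

/-- A graph parameter: an isomorphism-invariant real-valued function on finite graphs. -/
structure GraphParameter where
  toFun : FinGraph → ℝ
  iso_inv : ∀ G H : FinGraph, Nonempty (G.2 ≃g H.2) → toFun G = toFun H

def GraphParameter.BoundedOn (σ : GraphParameter) (C : GraphClass) : Prop :=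
  ∃ κ : ℕ, ∀ G ∈ C.carrier, σ.toFun G ≤ (κ : ℝ)

/-- The class of all graphs `G` with `σ(G) ≤ κ`. -/
def GraphParameter.sublevel (σ : GraphParameter) (κ : ℕ) : GraphClass where
  carrier := {G | σ.toFun G ≤ (κ : ℝ)}
  iso_closed := fun G H h hG => (σ.iso_inv G H h).symm.le.trans hG

/-- A `c`-factorial parameter: all its sublevel classes are `c`-factorial, and it is unbounded on
every hereditary class that is not `c`-factorial. -/
def GraphParameter.IsFactorial (c : ℝ) (σ : GraphParameter) : Prop :=
  (∀ κ : ℕ, (σ.sublevel κ).IsFactorial c) ∧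
    ∀ C : GraphClass, C.Hereditary → ¬ C.IsFactorial c → ¬ σ.BoundedOn C

/-- A set of parameters describes a family of classes if every class in the family has some
parameter of the set bounded on it. -/
def Describes (S : Set GraphParameter) (F : Set GraphClass) : Prop :=
  ∀ C ∈ F, ∃ σ ∈ S, σ.BoundedOn C

end TinyClasses

/-! A diagonal argument yields one infinite graph whose finite subgraphs form the class. By
`exists_degree_girth_count` there are constants `D`, `k` such that, for all large `N`, more than `N
^ (c * N)` labeled graphs on `N` vertices have maximum degree at most `D` and only cycles longer
than `log₂ N / k`. A sublevel class of a `c`-factorial parameter is too small to contain them all.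
So for each of the countably many pairs of a parameter `σ` and a bound `κ` some such graph has `σ >
κ`, and on the disjoint union of the chosen graphs every parameter of the set is unbounded.

The point is that the finite subgraphs of this union still form a tiny class
(`subgraphClass_isTiny`). A component with a cycle lies in some block on `N` vertices and has at
least about `log N` vertices, so the `O(log N)` bits that locate one of its vertices are paid for by
its size; bounded degree then lets it be explored at constant cost per vertex. The remaining
components are trees, which need no location and can be drawn abstractly as binary words. In all, an
`n`-vertex subgraph is traced by `O(n)` instructions from a fixed finite set
(`drawn_of_isContained`), and such traces encode only exponentially many isomorphism types
(`ncard_drawn_le`). -/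

namespace TinyClasses

open SimpleGraph

/-! ### Counting graphs of bounded degree and logarithmic girth -/

section Greedy

/-- A short cycle through a new edge closes up a short walk between its ends. -/
theorem lt_length_of_isCycle_sup_edge {V : Type*} {G : SimpleGraph V} {u v : V} {g : ℕ}
    (hG : ∀ x, ∀ p : G.Walk x x, p.IsCycle → g < p.length)
    (hfar : ∀ p : G.Walk u v, g ≤ p.length) {x : V} (c : (G ⊔ edge u v).Walk x x)
    (hc : c.IsCycle) : g < c.length := by
  classical
  by_cases he : s(u, v) ∈ c.edges
  -- `K` consists of the edges of the cycle alone. Deleting the new edge leaves a path between its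
  -- ends that uses at most `c.length - 1` distinct old edges.
  · let K : SimpleGraph V := fromEdgeSet {e | e ∈ c.edges}
    have hK : ∀ e ∈ c.edges, e ∈ K.edgeSet := by
      intro e he
      simp only [K, edgeSet_fromEdgeSet, Set.mem_sdiff, Set.mem_ofPred_eq]
      exact ⟨he, fun h => not_isDiag_of_mem_edgeSet _ (c.edges_subset_edgeSet he) h⟩
    have hcK := hc.transfer hK
    obtain ⟨-, hr⟩ := (adj_and_reachable_delete_edges_iff_exists_cycle (G := K)).2
      ⟨x, c.transfer K hK, hcK, by simpa using he⟩
    obtain ⟨p, hp⟩ := hr.exists_isPath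
    have hsub : ∀ e ∈ p.edges, e ∈ c.edges ∧ e ≠ s(u, v) := by
      intro e h
      have := p.edges_subset_edgeSet h
      simp only [K, edgeSet_deleteEdges, edgeSet_fromEdgeSet] at this
      exact ⟨this.1.1, this.2⟩
    have hpG : ∀ e ∈ p.edges, e ∈ G.edgeSet := by
      intro e h
      have h1 := c.edges_subset_edgeSet (hsub e h).1
      rw [edgeSet_sup] at h1
      rcases h1 with h1 | h1
      · exact h1
      · exact absurd (edgeSet_edge_subset h1) (hsub e h).2
    have h1 := hfar (p.transfer G hpG)
    rw [Walk.length_transfer] at h1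
    have h2 : p.edges.toFinset.card ≤ (c.edges.toFinset.erase s(u, v)).card := by
      apply Finset.card_le_card
      intro e h
      have := hsub e (by simpa using h)
      simp [this.1, this.2]
    rw [List.toFinset_card_of_nodup hp.isTrail.edges_nodup,
      Finset.card_erase_of_mem (by simpa using he),
      List.toFinset_card_of_nodup hc.isTrail.edges_nodup, Walk.length_edges,
      Walk.length_edges] at h2
    have := hc.three_le_length
    omega
  · have hcG : ∀ e ∈ c.edges, e ∈ G.edgeSet := by
      intro e h
      have h1 := c.edges_subset_edgeSet h
      rw [edgeSet_sup] at h1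
      rcases h1 with h1 | h1
      · exact h1
      · exact absurd (Set.mem_singleton_iff.1 (edgeSet_edge_subset h1)) (fun h' => he (h' ▸ h))
    have := hG x (c.transfer G hcG) (hc.transfer hcG)
    simpa using this

open Classical in
/-- The ball of radius `k`. -/
theorem card_walk_ball_le {V : Type*} [Fintype V] (G : SimpleGraph V) (D : ℕ)
    (hD : ∀ x, G.degree x ≤ D) (u : V) (k : ℕ) :
    (Finset.univ.filter fun v => ∃ p : G.Walk u v, p.length ≤ k).card ≤ (D + 1) ^ k := by
  induction k with
  | zero =>
    rw [pow_zero, Finset.card_le_one]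
    intro a ha b hb
    simp only [Finset.mem_filter, Finset.mem_univ, true_and] at ha hb
    obtain ⟨p, hp⟩ := ha
    obtain ⟨q, hq⟩ := hb
    rw [← Walk.eq_of_length_eq_zero (Nat.le_zero.1 hp),
      ← Walk.eq_of_length_eq_zero (Nat.le_zero.1 hq)]
  | succ k ih =>
    have hsub : (Finset.univ.filter fun v => ∃ p : G.Walk u v, p.length ≤ k + 1) ⊆
        (Finset.univ.filter fun v => ∃ p : G.Walk u v, p.length ≤ k).biUnion
          fun w => insert w (G.neighborFinset w) := by
      intro v hv
      simp only [Finset.mem_filter, Finset.mem_univ, true_and, Finset.mem_biUnion] at hv ⊢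
      obtain ⟨p, hp⟩ := hv
      by_cases hn : p.Nil
      · exact ⟨v, ⟨p, by rw [Walk.length_eq_zero_iff.2 hn]; omega⟩, by simp⟩
      · refine ⟨p.penultimate, ⟨p.dropLast, ?_⟩, ?_⟩
        · rw [Walk.length_dropLast]; omega
        · simp [p.adj_penultimate hn]
    calc _ ≤ _ := Finset.card_le_card hsub
      _ ≤ _ * (D + 1) := Finset.card_biUnion_le_card_mul _ _ _ fun w _ =>
          (Finset.card_insert_le _ _).trans (by simpa using hD w)
      _ ≤ (D + 1) ^ (k + 1) := by rw [pow_succ]; gcongr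

open Classical in
/-- Graphs on `Fin N` with `m` edges, maximum degree at most `D`, all of whose cycles are longer
than `g`. -/
noncomputable def sparseGraphs (N D g m : ℕ) : Finset (SimpleGraph (Fin N)) :=
  Finset.univ.filter fun G => G.edgeFinset.card = m ∧ (∀ x, G.degree x ≤ D) ∧
    ∀ x, ∀ p : G.Walk x x, p.IsCycle → g < p.length

open Classical in
/-- Pairs whose addition as an edge keeps a graph sparse. -/
noncomputable def farPairs {N : ℕ} (D g : ℕ) (G : SimpleGraph (Fin N)) :
    Finset (Fin N × Fin N) :=
  Finset.univ.filter fun e => G.degree e.1 < D ∧ G.degree e.2 < D ∧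
    ∀ p : G.Walk e.1 e.2, g < p.length

/-- By the degree sum, at most half of the vertices have full degree `4 * d`. A ball of radius `g`
contains at most a quarter of all vertices, so each unsaturated vertex has at least `N / 4`
unsaturated vertices outside its ball: at least `N / 2 * N / 4` ordered pairs. -/
theorem le_card_farPairs {N d g m : ℕ} (hN : 4 * (4 * d + 1) ^ g ≤ N) (hm : m < d * N)
    {G : SimpleGraph (Fin N)} (hG : G ∈ sparseGraphs N (4 * d) g m) :
    N * N ≤ 8 * (farPairs (4 * d) g G).card := by
  classical
  obtain ⟨-, hGm, hGD, -⟩ := Finset.mem_filter.1 hG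
  set A : Finset (Fin N) := Finset.univ.filter fun x => G.degree x < 4 * d with hA
  have hsum := G.sum_degrees_eq_twice_card_edges
  have hcompl : (Finset.univ.filter fun x => ¬ G.degree x < 4 * d).card * (4 * d) ≤ 2 * m := by
    calc _ ≤ ∑ x ∈ Finset.univ.filter (fun x => ¬ G.degree x < 4 * d), G.degree x := by
          rw [← smul_eq_mul]
          exact Finset.card_nsmul_le_sum _ _ _ fun x hx => by simpa using hx
      _ ≤ ∑ x, G.degree x := Finset.sum_le_sum_of_subset (Finset.subset_univ _)
      _ = 2 * m := by rw [hsum]; convert congrArg (2 * ·) hGm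
  have hAc : A.card + (Finset.univ.filter fun x => ¬ G.degree x < 4 * d).card = N := by
    simpa using Finset.card_filter_add_card_filter_not (s := Finset.univ)
      (fun x => G.degree x < 4 * d)
  have hA2 : N ≤ 2 * A.card := by
    by_contra h
    have h1 : N ≤ 2 * (Finset.univ.filter fun x => ¬ G.degree x < 4 * d).card := by omega
    have h2 := Nat.mul_le_mul_left d h1
    nlinarith
  have hfib : ∀ u ∈ A, N ≤ 4 * (A.filter fun v => ∀ p : G.Walk u v, g < p.length).card := by
    intro u _
    have h1 := card_walk_ball_le G (4 * d) hGD u g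
    have h2 := Finset.card_filter_add_card_filter_not (s := A)
      (fun v => ∀ p : G.Walk u v, g < p.length)
    have h3 : (A.filter fun v => ¬ ∀ p : G.Walk u v, g < p.length).card ≤
        (Finset.univ.filter fun v => ∃ p : G.Walk u v, p.length ≤ g).card := by
      apply Finset.card_le_card
      intro v hv
      simpa using (Finset.mem_filter.1 hv).2
    omega
  have hpairs : (A.sigma fun u => A.filter fun v => ∀ p : G.Walk u v, g < p.length).card ≤
      (farPairs (4 * d) g G).card := by
    refine Finset.card_le_card_of_injOn (fun e => (e.1, e.2)) ?_ ?_
    · rintro ⟨u, v⟩ h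
      simp only [Finset.mem_coe, Finset.mem_sigma, Finset.mem_filter, hA, Finset.mem_univ,
        true_and] at h
      simp only [farPairs, Finset.coe_filter, Finset.mem_univ, true_and, Set.mem_ofPred_eq]
      exact ⟨h.1, h.2.1, h.2.2⟩
    · rintro ⟨u, v⟩ _ ⟨u', v'⟩ _ h
      simp only [Prod.mk.injEq] at h
      obtain ⟨rfl, rfl⟩ := h
      rfl
  rw [Finset.card_sigma] at hpairs
  have h4 : A.card * N ≤ 4 * (farPairs (4 * d) g G).card := by
    calc A.card * N = ∑ u ∈ A, N := by simp
      _ ≤ ∑ u ∈ A, 4 * (A.filter fun v => ∀ p : G.Walk u v, g < p.length).card :=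
          Finset.sum_le_sum hfib
      _ ≤ _ := by rw [← Finset.mul_sum]; gcongr
  nlinarith

theorem sup_edge_mem_sparseGraphs {N D g m : ℕ} {G : SimpleGraph (Fin N)}
    (hG : G ∈ sparseGraphs N D g m) {u v : Fin N} (huv : (u, v) ∈ farPairs D g G)
    (hne : u ≠ v) (hadj : ¬ G.Adj u v) :
    G ⊔ edge u v ∈ sparseGraphs N D g (m + 1) := by
  classical
  obtain ⟨-, hGm, hGD, hGg⟩ := Finset.mem_filter.1 hG
  obtain ⟨-, hu, hv, hfar⟩ := Finset.mem_filter.1 huv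
  have hcard : (G ⊔ edge u v).edgeFinset.card = m + 1 := by
    rw [card_edgeFinset_sup_edge G hadj hne, ← hGm]
  -- As an `ncard` the edge count carries no decidability instance, so the enlarged graph can be
  -- generalized to a variable.
  rw [← Set.ncard_coe_finset, coe_edgeFinset] at hcard
  have hcyc : ∀ x, ∀ p : (G ⊔ edge u v).Walk x x, p.IsCycle → g < p.length := fun x p hp =>
    lt_length_of_isCycle_sup_edge hGg (fun p => (hfar p).le) p hp
  have hnb : ∀ x z, (G ⊔ edge u v).Adj x z → G.Adj x z ∨ (x = u ∧ z = v) ∨ (x = v ∧ z = u) := by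
    intro x z h
    simp only [sup_adj, edge_adj] at h
    tauto
  generalize G ⊔ edge u v = G' at *
  refine Finset.mem_filter.2 ⟨Finset.mem_univ _, by rw [← hcard, ← Set.ncard_coe_finset, coe_edgeFinset], fun x => ?_, hcyc⟩
  have hle : ∀ y, (∀ z, G'.Adj x z → G.Adj x z ∨ z = y) →
      G.degree x < D → G'.degree x ≤ D := by
    intro y h1 h2
    have h3 : G'.neighborFinset x ⊆ insert y (G.neighborFinset x) := by
      intro z hz
      have := h1 z (by simpa using hz)
      simpa using this.symm
    rw [← card_neighborFinset_eq_degree]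
    refine (Finset.card_le_card h3).trans ((Finset.card_insert_le _ _).trans ?_)
    rw [card_neighborFinset_eq_degree]
    omega
  by_cases hxu : x = u
  · subst hxu
    exact hle v (by grind) hu
  by_cases hxv : x = v
  · subst hxv
    exact hle u (by grind) hv
  · refine le_trans ?_ (hGD x)
    rw [← card_neighborFinset_eq_degree, ← card_neighborFinset_eq_degree]
    apply Finset.card_le_card
    intro z hz
    simp only [mem_neighborFinset] at hz ⊢
    grind

/-- Double counting of edge additions: each graph with `m` edges extends along at least `N * N / 8`
ordered far pairs, while a graph with `m + 1` edges arises from at most `2 * (m + 1) ≤ 2 * d * N` of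
them, one for each orientation of the edge added last. -/
theorem card_sparseGraphs_mul_le {N d g m : ℕ} (hg : 1 ≤ g) (hN : 4 * (4 * d + 1) ^ g ≤ N)
    (hm : m < d * N) :
    (sparseGraphs N (4 * d) g m).card * N ≤
      (16 * d) * (sparseGraphs N (4 * d) g (m + 1)).card := by
  classical
  have hne : ∀ G : SimpleGraph (Fin N), ∀ e ∈ farPairs (4 * d) g G,
      e.1 ≠ e.2 ∧ ¬ G.Adj e.1 e.2 := by
    rintro G ⟨u, v⟩ he
    obtain ⟨-, -, -, hfar⟩ := Finset.mem_filter.1 he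
    constructor
    -- Far pairs are distinct because the empty walk is short, and nonadjacent because `1 ≤ g`.
    · rintro (rfl : u = v)
      simpa using hfar Walk.nil
    · intro h
      have := hfar h.toWalk
      simp at this
      omega
  have hinj : ((sparseGraphs N (4 * d) g m).sigma fun G => farPairs (4 * d) g G).card ≤
      ((sparseGraphs N (4 * d) g (m + 1)).sigma fun G =>
        Finset.univ.sigma fun x => G.neighborFinset x).card := by
    refine Finset.card_le_card_of_injOn
      (fun z => ⟨z.1 ⊔ edge z.2.1 z.2.2, z.2.1, z.2.2⟩) ?_ ?_
    · rintro ⟨G, u, v⟩ h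
      simp only [Finset.mem_coe, Finset.mem_sigma] at h
      obtain ⟨h1, h2⟩ := hne G _ h.2
      simp only [Finset.mem_coe, Finset.mem_sigma, Finset.mem_univ, true_and,
        mem_neighborFinset]
      exact ⟨sup_edge_mem_sparseGraphs h.1 h.2 h1 h2, by simp [edge_adj, h1]⟩
    · rintro ⟨G, u, v⟩ h ⟨G', u', v'⟩ h' heq
      simp only [Finset.mem_coe, Finset.mem_sigma] at h h'
      have hG := (hne G _ h.2).2
      have hG' := (hne G' _ h'.2).2
      simp only [Sigma.mk.injEq, heq_eq_eq] at heq
      obtain ⟨h1, rfl, rfl⟩ := heq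
      have : G = G' := by
        rw [← sdiff_edge _ hG, ← sdiff_edge _ hG', ← sup_sdiff_right_self, h1, sup_sdiff_right_self]
      subst this
      rfl
  rw [Finset.card_sigma, Finset.card_sigma] at hinj
  have hR : ∀ G ∈ sparseGraphs N (4 * d) g (m + 1),
      (Finset.univ.sigma fun x => G.neighborFinset x).card = 2 * (m + 1) := by
    intro G hG
    obtain ⟨-, hGm, -⟩ := Finset.mem_filter.1 hG
    rw [Finset.card_sigma]
    simp only [card_neighborFinset_eq_degree]
    rw [sum_degrees_eq_twice_card_edges, ← hGm]
  rw [Finset.sum_congr rfl hR, Finset.sum_const, smul_eq_mul] at hinj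
  have hL : (sparseGraphs N (4 * d) g m).card * (N * N) ≤
      8 * ∑ G ∈ sparseGraphs N (4 * d) g m, (farPairs (4 * d) g G).card := by
    rw [Finset.mul_sum, ← smul_eq_mul]
    exact Finset.card_nsmul_le_sum _ _ _ fun G hG => le_card_farPairs hN hm hG
  have hNpos : 0 < N := lt_of_lt_of_le (by positivity) hN
  refine Nat.le_of_mul_le_mul_right ?_ hNpos
  calc (sparseGraphs N (4 * d) g m).card * N * N
      = (sparseGraphs N (4 * d) g m).card * (N * N) := by ring
    _ ≤ 8 * ((sparseGraphs N (4 * d) g (m + 1)).card * (2 * (m + 1))) :=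
        hL.trans (Nat.mul_le_mul_left _ hinj)
    _ ≤ 8 * ((sparseGraphs N (4 * d) g (m + 1)).card * (2 * (d * N))) := by
        gcongr; omega
    _ = _ := by ring

theorem pow_le_card_sparseGraphs {N d g : ℕ} (hg : 1 ≤ g) (hN : 4 * (4 * d + 1) ^ g ≤ N)
    {m : ℕ} (hm : m ≤ d * N) :
    N ^ m ≤ (16 * d) ^ m * (sparseGraphs N (4 * d) g m).card := by
  classical
  induction m with
  | zero =>
    have : (⊥ : SimpleGraph (Fin N)) ∈ sparseGraphs N (4 * d) g 0 := by
      refine Finset.mem_filter.2 ⟨Finset.mem_univ _, ?_, ?_, ?_⟩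
      · rw [Finset.card_eq_zero, ← Finset.coe_eq_empty, coe_edgeFinset, edgeSet_bot]
      · intro x
        rw [← card_neighborFinset_eq_degree, Finset.card_eq_zero.2 (by ext z; simp)]
        exact Nat.zero_le _
      · intro x p hp
        exact absurd rfl hp.ne_bot
    simpa using Finset.card_pos.2 ⟨_, this⟩
  | succ m ih =>
    have h := card_sparseGraphs_mul_le hg hN (show m < d * N by omega)
    calc N ^ (m + 1) ≤ ((16 * d) ^ m * (sparseGraphs N (4 * d) g m).card) * N := by
          rw [pow_succ]; exact Nat.mul_le_mul_right _ (ih (by omega))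
      _ ≤ (16 * d) ^ m * ((16 * d) * (sparseGraphs N (4 * d) g (m + 1)).card) := by
          rw [mul_assoc]; exact Nat.mul_le_mul_left _ h
      _ = _ := by ring

/-- There are more than `N ^ (c * N)` labeled graphs of bounded degree and logarithmic girth. -/
theorem exists_degree_girth_count (c : ℝ) : ∃ D k : ℕ, ∀ᶠ N : ℕ in Filter.atTop,
    ∃ F : Set (SimpleGraph (Fin N)), (N : ℝ) ^ (c * (N : ℝ)) < F.ncard ∧
      ∀ G ∈ F, (∀ x, (G.neighborSet x).ncard ≤ D) ∧
        ∀ x, ∀ p : G.Walk x x, p.IsCycle → N < 2 ^ (k * p.length) := by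
  classical
  obtain ⟨d, hd⟩ := exists_nat_gt (max (2 * c) 0)
  have hd1 : 2 * c < d := (le_max_left _ _).trans_lt hd
  have hd0 : 0 < d := by exact_mod_cast (le_max_right _ _).trans_lt hd
  -- The girth constant comes from `4 = 2 ^ 2` and `4 * d + 1 ≤ 2 ^ (4 * d + 1)`, applied to `N < 4
  -- * (4 * d + 1) ^ (g + 1)` and `g + 1 ≤ p.length`.
  refine ⟨4 * d, 2 + (4 * d + 1), ?_⟩
  filter_upwards [Filter.eventually_ge_atTop (4 * (4 * d + 1)),
    Filter.eventually_ge_atTop ((16 * d) ^ 2)] with N hN1 hN2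
  have hb : 1 < 4 * d + 1 := by omega
  -- The largest `g` for which the greedy count applies.
  set g := Nat.log (4 * d + 1) (N / 4) with hgdef
  have hN4 : 4 * d + 1 ≤ N / 4 := by omega
  have hg1 : 1 ≤ g := Nat.log_pos hb hN4
  have hgN : 4 * (4 * d + 1) ^ g ≤ N := by
    have := Nat.pow_log_le_self (4 * d + 1) (show N / 4 ≠ 0 by omega)
    rw [← hgdef] at this
    omega
  have hNg : N < 4 * (4 * d + 1) ^ (g + 1) := by
    have := Nat.lt_pow_succ_log_self hb (N / 4)
    rw [← hgdef, Nat.succ_eq_add_one] at this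
    omega
  refine ⟨(sparseGraphs N (4 * d) g (d * N) : Set _), ?_, ?_⟩
  · rw [Set.ncard_coe_finset]
    by_contra! hle
    have h1 := pow_le_card_sparseGraphs hg1 hgN (le_refl (d * N))
    have h2 : (N : ℝ) ^ (d * N) ≤ (16 * d : ℝ) ^ (d * N) * (N : ℝ) ^ (c * N) := by
      have h1' : (N : ℝ) ^ (d * N) ≤
          (16 * d : ℝ) ^ (d * N) * (sparseGraphs N (4 * d) g (d * N)).card := by
        exact_mod_cast h1
      exact h1'.trans (by gcongr)
    have hNpos : (1 : ℝ) < N := by exact_mod_cast (show 1 < N by omega)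
    have hN0 : (0 : ℝ) < N := by linarith
    -- The factor lost per edge is at most `√N`, so at least `N ^ (d * N / 2)` graphs remain, which
    -- beats `N ^ (c * N)` since `d > 2 * c`.
    have h3 : (16 * d : ℝ) ≤ (N : ℝ) ^ (1 / 2 : ℝ) := by
      rw [← Real.sqrt_eq_rpow]
      apply Real.le_sqrt_of_sq_le
      exact_mod_cast hN2
    have h4 : (16 * d : ℝ) ^ (d * N) ≤ (N : ℝ) ^ ((1 / 2 : ℝ) * (d * N)) := by
      rw [Real.rpow_mul hN0.le]
      calc _ ≤ ((N : ℝ) ^ (1 / 2 : ℝ)) ^ (d * N) := by gcongr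
        _ = _ := by rw [← Real.rpow_natCast]; push_cast; rfl
    have h5 : (N : ℝ) ^ ((d * N : ℕ) : ℝ) ≤ (N : ℝ) ^ ((1 / 2 : ℝ) * (d * N) + c * N) := by
      rw [Real.rpow_natCast, Real.rpow_add hN0]
      exact h2.trans (by gcongr)
    rw [Real.rpow_le_rpow_left_iff hNpos] at h5
    push_cast at h5
    nlinarith
  · intro G hG
    obtain ⟨-, -, hGD, hGg⟩ := Finset.mem_filter.1 (Finset.mem_coe.1 hG)
    refine ⟨fun x => ?_, fun x p hp => ?_⟩
    · rw [← coe_neighborFinset, Set.ncard_coe_finset]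
      simpa using hGD x
    · have := hGg x p hp
      calc N < 4 * (4 * d + 1) ^ (g + 1) := hNg
        _ ≤ 2 ^ (2 * p.length) * (2 ^ (4 * d + 1)) ^ p.length := by
            apply Nat.mul_le_mul
            · calc 4 = 2 ^ 2 := rfl
                _ ≤ _ := Nat.pow_le_pow_right (by norm_num) (by omega)
            · calc _ ≤ (2 ^ (4 * d + 1)) ^ (g + 1) :=
                    Nat.pow_le_pow_left Nat.lt_two_pow_self.le _
                _ ≤ _ := Nat.pow_le_pow_right (by positivity) (by omega)
        _ = _ := by rw [← pow_mul, ← pow_add, ← add_mul]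

end Greedy

/-! ### Graphs traced by words of operations -/

section Machine

variable {V A : Type*}

/-- The state reached from `r` by performing the operations of a word from left to right. -/
def run (f : A → V → V) (r : V) (w : List A) : V := w.foldl (fun x a => f a x) r

/-- The run of the word `w` from `r` passes through `x`. -/
def Visits (f : A → V → V) (r : V) (w : List A) (x : V) : Prop :=
  ∃ w', w' <+: w ∧ run f r w' = x

theorem run_append (f : A → V → V) (r : V) (w₁ w₂ : List A) :
    run f r (w₁ ++ w₂) = run f (run f r w₁) w₂ := by
  simp [run, List.foldl_append]

theorem Visits.append_right {f : A → V → V} {r : V} {w₁ : List A} {x : V}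
    (h : Visits f r w₁ x) (w₂ : List A) : Visits f r (w₁ ++ w₂) x := by
  obtain ⟨p, hp, hx⟩ := h
  exact ⟨p, hp.trans (List.prefix_append _ _), hx⟩

theorem Visits.append_left {f : A → V → V} {r : V} (w₁ : List A) {w₂ : List A} {x : V}
    (h : Visits f (run f r w₁) w₂ x) : Visits f r (w₁ ++ w₂) x := by
  obtain ⟨p, hp, hx⟩ := h
  exact ⟨w₁ ++ p, (List.prefix_append_right_inj _).2 hp, by rw [run_append, hx]⟩

/-- A set that can be grown from `r` one element at a time by reversible steps is covered by a
word of at most twice its size. -/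
theorem exists_word_visits (f : A → V → V) (r : V) (S : Finset V) (hr : r ∈ S)
    (hgrow : ∀ T ⊂ S, r ∈ T → ∃ u ∈ T, ∃ v ∈ S, v ∉ T ∧ ∃ a b, f a u = v ∧ f b v = u) :
    ∃ w : List A, w.length ≤ 2 * S.card ∧ ∀ x ∈ S, Visits f r w x := by
  classical
  have key : ∀ k, k + 1 ≤ S.card → ∃ T ⊆ S, r ∈ T ∧ T.card = k + 1 ∧
      ∃ w : List A, w.length ≤ 2 * (k + 1) ∧ ∀ x ∈ T, Visits f r w x := by
    intro k
    induction k with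
    | zero =>
      intro _
      refine ⟨{r}, by simpa using hr, by simp, by simp, [], by simp, ?_⟩
      intro x hx
      exact ⟨[], List.prefix_refl _, (Finset.mem_singleton.1 hx).symm⟩
    | succ k ih =>
      intro hk
      obtain ⟨T, hTS, hrT, hTc, w, hw, hvis⟩ := ih (by omega)
      have hss : T ⊂ S := by
        refine hTS.ssubset_of_ne ?_
        rintro rfl
        omega
      obtain ⟨u, hu, v, hvS, hvT, a, b, hab, hba⟩ := hgrow T hss hrT
      obtain ⟨w₁, hw₁, hru⟩ := hvis u hu
      obtain ⟨w₂, rfl⟩ := hw₁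
      -- Splice the detour `[a, b]`, from `u` to `v` and back, into the word at a moment when it is
      -- at `u`; the rest of the run is unchanged.
      refine ⟨insert v T, Finset.insert_subset hvS hTS, Finset.mem_insert_of_mem hrT,
        by rw [Finset.card_insert_of_notMem hvT, hTc], w₁ ++ ([a, b] ++ w₂), ?_, ?_⟩
      · simp only [List.length_append, List.length_cons, List.length_nil] at hw ⊢
        omega
      · intro x hx
        rcases Finset.mem_insert.1 hx with rfl | hx
        · refine Visits.append_left _ (Visits.append_right ⟨[a], ⟨[b], rfl⟩, ?_⟩ _)
          simp [run, ← hab, ← hru]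
        · obtain ⟨p, hp, hpx⟩ := hvis x hx
          rcases List.prefix_or_prefix_of_prefix hp (List.prefix_append w₁ w₂) with h | h
          · exact Visits.append_right ⟨p, h, hpx⟩ _
          · obtain ⟨q, rfl⟩ := h
            rw [run_append, hru] at hpx
            refine Visits.append_left _ (Visits.append_left _
              ⟨q, (List.prefix_append_right_inj _).1 hp, ?_⟩)
            rw [hru, show run f u [a, b] = u by simp [run, hab, hba], hpx]
  have hpos : 0 < S.card := Finset.card_pos.2 ⟨r, hr⟩
  obtain ⟨T, hTS, -, hTc, w, hw, hvis⟩ := key (S.card - 1) (by omega)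
  obtain rfl := Finset.eq_of_subset_of_card_le hTS (by omega)
  exact ⟨w, by omega, hvis⟩

/-- The graph `H` has a copy whose vertices are states visited by a word of length at most `M`
and each of whose edges joins a state with its image under some operation. -/
def Drawn (f : A → V → V) (r : V) (M : ℕ) {n : ℕ} (H : SimpleGraph (Fin n)) : Prop :=
  ∃ φ : Fin n → V, Function.Injective φ ∧
    (∃ w : List A, w.length ≤ M ∧ ∀ u, Visits f r w (φ u)) ∧
    ∀ u v, H.Adj u v → (∃ a, f a (φ u) = φ v) ∨ ∃ a, f a (φ v) = φ u

/-- The data that determine a drawn graph up to isomorphism: the word, the times at which a vertex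
is visited, and the times and operations that trace an edge. -/
abbrev DrawingCode (A : Type*) (M : ℕ) : Type _ :=
  List.Vector A M × Set (Fin (M + 1)) × Set (Fin (M + 1) × A)

/-- The state at time `t`. -/
def stateAt (f : A → V → V) (r : V) {M : ℕ} (w : List.Vector A M) (t : Fin (M + 1)) : V :=
  run f r (w.1.take t)

/-- The code of a drawing. -/
def drawingCode (f : A → V → V) (r : V) {M n : ℕ} (H : SimpleGraph (Fin n)) (φ : Fin n → V)
    (w : List.Vector A M) : DrawingCode A M :=
  (w, {t | stateAt f r w t ∈ Set.range φ},
    {e | ∃ u v, H.Adj u v ∧ φ u = stateAt f r w e.1 ∧ φ v = f e.2 (stateAt f r w e.1)})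

/-- A word may be padded to length exactly `M`. -/
theorem Drawn.exists_vector [Nonempty A] {f : A → V → V} {r : V} {M n : ℕ}
    {H : SimpleGraph (Fin n)} (h : Drawn f r M H) :
    ∃ φ : Fin n → V, Function.Injective φ ∧
      (∃ w : List.Vector A M, ∀ u, ∃ t, stateAt f r w t = φ u) ∧
      ∀ u v, H.Adj u v → (∃ a, f a (φ u) = φ v) ∨ ∃ a, f a (φ v) = φ u := by
  obtain ⟨φ, hφ, ⟨w, hw, hvis⟩, hadj⟩ := h
  refine ⟨φ, hφ, ⟨⟨w ++ List.replicate (M - w.length) (Classical.arbitrary A), ?_⟩, ?_⟩, hadj⟩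
  · simp; omega
  · intro u
    obtain ⟨p, hp, hpu⟩ := hvis u
    have hlen := hp.length_le
    refine ⟨⟨p.length, by omega⟩, ?_⟩
    have := List.prefix_iff_eq_take.1 (hp.trans
      (List.prefix_append w (List.replicate (M - w.length) (Classical.arbitrary A))))
    simp only [stateAt]
    rw [← this, hpu]

/-- Drawings with the same code have the same edges. -/
theorem adj_of_drawingCode_eq {f : A → V → V} {r : V} {M n : ℕ} {H H' : SimpleGraph (Fin n)}
    {φ φ' : Fin n → V} {w w' : List.Vector A M}
    (hw : ∀ u, ∃ t, stateAt f r w t = φ u)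
    (hadj : ∀ u v, H.Adj u v → (∃ a, f a (φ u) = φ v) ∨ ∃ a, f a (φ v) = φ u)
    (hcode : drawingCode f r H φ w = drawingCode f r H' φ' w') {u v : Fin n} (h : H.Adj u v) :
    ∃ u' v', H'.Adj u' v' ∧ φ' u' = φ u ∧ φ' v' = φ v := by
  simp only [drawingCode, Prod.mk.injEq] at hcode
  obtain ⟨rfl, -, hE⟩ := hcode
  have key : ∀ u v, H.Adj u v → (∃ a, f a (φ u) = φ v) →
      ∃ u' v', H'.Adj u' v' ∧ φ' u' = φ u ∧ φ' v' = φ v := by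
    rintro u v h ⟨a, ha⟩
    obtain ⟨t, ht⟩ := hw u
    have h1 : (t, a) ∈ {e : Fin (M + 1) × A | ∃ u v, H.Adj u v ∧ φ u = stateAt f r w e.1 ∧
        φ v = f e.2 (stateAt f r w e.1)} := ⟨u, v, h, ht.symm, by rw [ht, ha]⟩
    rw [hE] at h1
    obtain ⟨u', v', h', hu', hv'⟩ := h1
    exact ⟨u', v', h', by rw [hu', ht], by rw [hv', ht, ha]⟩
  rcases hadj u v h with ha | ha
  · exact key u v h ha
  · obtain ⟨v', u', h', hv', hu'⟩ := key v u h.symm ha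
    exact ⟨u', v', h'.symm, hu', hv'⟩

/-- Equal codes have the same run and mark the same states as vertices, so the two drawings have the
same image; matching vertices with the same state transports edges in both directions. -/
theorem nonempty_iso_of_drawingCode_eq {f : A → V → V} {r : V} {M n : ℕ}
    {H H' : SimpleGraph (Fin n)} {φ φ' : Fin n → V} {w w' : List.Vector A M}
    (hφ : Function.Injective φ) (hφ' : Function.Injective φ')
    (hw : ∀ u, ∃ t, stateAt f r w t = φ u) (hw' : ∀ u, ∃ t, stateAt f r w' t = φ' u)
    (hadj : ∀ u v, H.Adj u v → (∃ a, f a (φ u) = φ v) ∨ ∃ a, f a (φ v) = φ u)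
    (hadj' : ∀ u v, H'.Adj u v → (∃ a, f a (φ' u) = φ' v) ∨ ∃ a, f a (φ' v) = φ' u)
    (hcode : drawingCode f r H φ w = drawingCode f r H' φ' w') : Nonempty (H ≃g H') := by
  have h1 : ∀ u, ∃ u', φ' u' = φ u := by
    intro u
    obtain ⟨t, ht⟩ := hw u
    have hV := hcode
    simp only [drawingCode, Prod.mk.injEq] at hV
    obtain ⟨rfl, hV, -⟩ := hV
    have : t ∈ {t | stateAt f r w t ∈ Set.range φ} := ⟨u, ht.symm⟩
    rw [hV] at this
    obtain ⟨u', hu'⟩ := this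
    exact ⟨u', by rw [hu', ht]⟩
  choose e he using h1
  have hinj : Function.Injective e := fun u v h => hφ (by rw [← he u, ← he v, h])
  refine ⟨⟨Equiv.ofBijective e (Finite.injective_iff_bijective.1 hinj), ?_⟩⟩
  intro u v
  simp only [Equiv.ofBijective_apply]
  constructor
  · intro h
    obtain ⟨u', v', h', hu', hv'⟩ := adj_of_drawingCode_eq hw' hadj' hcode.symm h
    rw [he] at hu' hv'
    rwa [← hφ hu', ← hφ hv']
  · intro h
    obtain ⟨u', v', h', hu', hv'⟩ := adj_of_drawingCode_eq hw hadj hcode h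
    rw [← he] at hu' hv'
    rwa [← hφ' hu', ← hφ' hv']

/-- There are at most exponentially many drawn graphs up to isomorphism. -/
theorem ncard_drawn_le [Fintype A] [Nonempty A] (f : A → V → V) (r : V) (M n : ℕ) :
    (Quotient.mk (isoSetoid n) '' {H | Drawn f r M H}).ncard ≤
      (Fintype.card A * (2 * 2 ^ Fintype.card A)) ^ (M + 1) := by
  classical
  have hex : ∀ q : Quotient (isoSetoid n), ∃ code : DrawingCode A M,
      q ∈ Quotient.mk (isoSetoid n) '' {H | Drawn f r M H} →
      ∃ H φ, ∃ w : List.Vector A M, Quotient.mk (isoSetoid n) H = q ∧ Function.Injective φ ∧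
        (∀ u, ∃ t, stateAt f r w t = φ u) ∧
        (∀ u v, H.Adj u v → (∃ a, f a (φ u) = φ v) ∨ ∃ a, f a (φ v) = φ u) ∧
        code = drawingCode f r H φ w := by
    intro q
    by_cases hq : q ∈ Quotient.mk (isoSetoid n) '' {H | Drawn f r M H}
    · obtain ⟨H, hH, rfl⟩ := hq
      obtain ⟨φ, hφ, ⟨w, hw⟩, hadj⟩ := Drawn.exists_vector hH
      exact ⟨drawingCode f r H φ w, fun _ => ⟨H, φ, w, rfl, hφ, hw, hadj, rfl⟩⟩
    -- A dummy code: injectivity is only needed on classes of drawn graphs.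
    · exact ⟨⟨List.Vector.replicate M (Classical.arbitrary A), ∅, ∅⟩, fun h => absurd h hq⟩
  choose code hcode using hex
  have h1 : (Quotient.mk (isoSetoid n) '' {H | Drawn f r M H}).ncard ≤
      (Set.univ : Set (DrawingCode A M)).ncard := by
    refine Set.ncard_le_ncard_of_injOn code (fun _ _ => Set.mem_univ _) ?_ (Set.toFinite _)
    intro q hq q' hq' heq
    obtain ⟨H, φ, w, rfl, hφ, hw, hadj, hc⟩ := hcode q hq
    obtain ⟨H', φ', w', rfl, hφ', hw', hadj', hc'⟩ := hcode q' hq'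
    exact Quotient.sound
      (nonempty_iso_of_drawingCode_eq hφ hφ' hw hw' hadj hadj' (by rw [← hc, heq, hc']))
  refine h1.trans ?_
  rw [Set.ncard_univ, Nat.card_eq_fintype_card, Fintype.card_prod, Fintype.card_prod,
    card_vector, Fintype.card_set, Fintype.card_set, Fintype.card_prod, Fintype.card_fin,
    mul_pow, mul_pow, ← pow_mul, mul_comm (Fintype.card A) (M + 1)]
  gcongr
  · exact Fintype.card_pos
  · omega

end Machine

/-! ### Drawing forests by binary words -/

section Forest

/-- A finite forest has a vertex with at most one neighbor. -/
theorem exists_neighborSet_subsingleton {V : Type*} [Finite V] [Nonempty V] {G : SimpleGraph V}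
    (hG : G.IsAcyclic) : ∃ x, ∀ y z, G.Adj x y → G.Adj x z → y = z := by
  classical
  have := Fintype.ofFinite V
  rcases subsingleton_or_nontrivial V with h | h
  · exact ⟨Classical.arbitrary V, fun y z _ _ => Subsingleton.elim _ _⟩
  -- Extend the forest to a spanning tree of the complete graph; a leaf of the tree has at most one
  -- neighbor in the forest.
  · obtain ⟨T, hGT, -, hT⟩ :=
      (connected_top (V := V)).exists_isTree_le_of_le_of_isAcyclic le_top hG
    obtain ⟨x, hx⟩ := hT.exists_vert_degree_one_of_nontrivial
    refine ⟨x, fun y z hy hz => ?_⟩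
    rw [← card_neighborFinset_eq_degree] at hx
    exact Finset.card_le_one.1 hx.le y (by simpa using hGT hy) z (by simpa using hGT hz)

/-- In the left-child right-sibling encoding of forests by binary words, the parent of a word is
obtained by removing all leading `true`s and then the leading `false`. -/
def wordParent (l : List Bool) : List Bool := (l.dropWhile id).tail

theorem wordParent_replicate_append (j : ℕ) (l : List Bool) :
    wordParent (List.replicate j true ++ false :: l) = l := by
  induction j with
  | zero => simp [wordParent]
  | succ j ih => simp_all [wordParent, List.replicate_succ]

/-- A finite forest embeds into binary words, with range closed under suffixes, such that edges
join words with their parents. -/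
theorem exists_forest_embedding {V : Type*} [Finite V] {G : SimpleGraph V} (hG : G.IsAcyclic) :
    ∃ f : V → List Bool, Function.Injective f ∧
      (∀ b l, b :: l ∈ Set.range f → l ∈ Set.range f) ∧
      ∀ u v, G.Adj u v → wordParent (f u) = f v ∨ wordParent (f v) = f u := by
  classical
  have := Fintype.ofFinite V
  suffices h : ∀ k, ∀ s : Finset V, s.card = k → ∃ f : V → List Bool, Set.InjOn f s ∧
      (∀ b l, b :: l ∈ s.image f → l ∈ s.image f) ∧
      ∀ u ∈ s, ∀ v ∈ s, G.Adj u v → wordParent (f u) = f v ∨ wordParent (f v) = f u by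
    obtain ⟨f, h1, h2, h3⟩ := h _ Finset.univ rfl
    refine ⟨f, by simpa [Set.injOn_univ] using h1, by simpa using h2, by simpa using h3⟩
  intro k
  induction k with
  | zero =>
    intro s hs
    rw [Finset.card_eq_zero] at hs
    subst hs
    exact ⟨fun _ => [], by simp, by simp, by simp⟩
  | succ k ih =>
    intro s hs
    have hne : Nonempty (s : Set V) := by
      obtain ⟨x, hx⟩ := Finset.card_pos.1 (by omega : 0 < s.card)
      exact ⟨⟨x, hx⟩⟩
    obtain ⟨⟨x, hxs⟩, hx⟩ := exists_neighborSet_subsingleton (hG.induce (s : Set V))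
    have hxs' : x ∈ s := hxs
    have huniq : ∀ y ∈ s, ∀ z ∈ s, G.Adj x y → G.Adj x z → y = z := by
      intro y hy z hz hxy hxz
      simpa using hx ⟨y, hy⟩ ⟨z, hz⟩ (by simpa using hxy) (by simpa using hxz)
    obtain ⟨f, hinj, hsuf, hadj⟩ := ih (s.erase x) (by rw [Finset.card_erase_of_mem hxs']; omega)
    -- The removed vertex `x` becomes a child of its only neighbor, or a root if it has none.
    -- Leading `true`s, which `wordParent` ignores, move it past the siblings already placed.
    obtain ⟨base, hbase, hpar⟩ : ∃ base : List Bool,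
        (∀ b l, b :: l = base → l ∈ (s.erase x).image f) ∧
        ∀ y ∈ s, G.Adj x y → base = false :: f y := by
      by_cases h : ∃ y ∈ s, G.Adj x y
      · obtain ⟨y, hy, hxy⟩ := h
        refine ⟨false :: f y, ?_, fun z hz hxz => by rw [huniq y hy z hz hxy hxz]⟩
        intro b l h
        rw [List.cons.injEq] at h
        rw [h.2]
        exact Finset.mem_image_of_mem _ (Finset.mem_erase.2 ⟨hxy.ne', hy⟩)
      · exact ⟨[], by simp, fun y hy hxy => absurd ⟨y, hy, hxy⟩ h⟩
    have hfresh : ∃ j, List.replicate j true ++ base ∉ (s.erase x).image f := by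
      by_contra! hall
      refine Set.infinite_of_injective_forall_mem (f := fun j : ℕ => List.replicate j true ++ base)
        ?_ (fun j => Finset.mem_coe.2 (hall j)) (Finset.finite_toSet _)
      intro i j hij
      have := congrArg List.length hij
      simpa using this
    -- Minimality of `j` keeps the range suffix-closed: with one `true` fewer the word is already
    -- taken.
    set j := Nat.find hfresh with hj
    have hjnew : List.replicate j true ++ base ∉ (s.erase x).image f := Nat.find_spec hfresh
    have hjmin : ∀ b l, b :: l = List.replicate j true ++ base → l ∈ (s.erase x).image f := by
      intro b l h
      rcases hj0 : j with _ | i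
      · rw [hj0] at h
        exact hbase b l (by simpa using h)
      · rw [hj0, List.replicate_succ, List.cons_append, List.cons.injEq] at h
        rw [h.2]
        by_contra hi
        have := Nat.find_min' hfresh hi
        omega
    set f' : V → List Bool := Function.update f x (List.replicate j true ++ base) with hf'
    have hf'x : f' x = List.replicate j true ++ base := by simp [hf']
    have hf'y : ∀ y, y ≠ x → f' y = f y := fun y hy => by simp [hf', hy]
    have himg : s.image f' = insert (List.replicate j true ++ base) ((s.erase x).image f) := by
      rw [← Finset.insert_erase hxs', Finset.image_insert, hf'x, Finset.erase_insert_eq_erase,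
        Finset.erase_idem]
      congr 1
      exact Finset.image_congr fun y hy => hf'y y (Finset.ne_of_mem_erase hy)
    have hnew : ∀ y ∈ s, y ≠ x → f y ≠ List.replicate j true ++ base := fun y hy hyx h =>
      hjnew (h ▸ Finset.mem_image_of_mem f (Finset.mem_erase.2 ⟨hyx, hy⟩))
    refine ⟨f', ?_, ?_, ?_⟩
    · intro y hy z hz hyz
      have hy' : y ∈ s := hy
      have hz' : z ∈ s := hz
      by_cases hyx : y = x <;> by_cases hzx : z = x
      · rw [hyx, hzx]
      · rw [hyx, hf'x, hf'y z hzx] at hyz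
        exact absurd hyz.symm (hnew z hz' hzx)
      · rw [hzx, hf'x, hf'y y hyx] at hyz
        exact absurd hyz (hnew y hy' hyx)
      · rw [hf'y y hyx, hf'y z hzx] at hyz
        exact hinj (by simp [hyx, hy']) (by simp [hzx, hz']) hyz
    · intro b l hbl
      rw [himg, Finset.mem_insert] at hbl ⊢
      rcases hbl with h | h
      · exact Or.inr (hjmin b l h)
      · exact Or.inr (hsuf b l h)
    · have hxy : ∀ y ∈ s, G.Adj x y → wordParent (f' x) = f' y := by
        intro y hy h
        rw [hf'x, hpar y hy h, wordParent_replicate_append, hf'y y h.ne']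
      intro u hu v hv huv
      by_cases hux : u = x
      · subst hux
        exact Or.inl (hxy v hv huv)
      by_cases hvx : v = x
      · subst hvx
        exact Or.inr (hxy u hu huv.symm)
      · rw [hf'y u hux, hf'y v hvx]
        exact hadj u (Finset.mem_erase.2 ⟨hux, hu⟩) v (Finset.mem_erase.2 ⟨hvx, hv⟩) huv

end Forest

/-! ### The concrete machine on words and numbers -/

section Tape

/-- The number with the given binary digits, least significant first. -/
def binaryValue : List Bool → ℕ
  | [] => 0
  | b :: l => 2 * binaryValue l + b.toNat

theorem exists_binaryValue_eq (k x : ℕ) (hx : x < 2 ^ k) :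
    ∃ l : List Bool, l.length = k ∧ binaryValue l = x := by
  induction k generalizing x with
  | zero => exact ⟨[], rfl, by simp at hx; simp [binaryValue, hx]⟩
  | succ k ih =>
    obtain ⟨l, hl, hv⟩ := ih (x / 2) (by rw [pow_succ] at hx; omega)
    refine ⟨decide (x % 2 = 1) :: l, by simp [hl], ?_⟩
    rw [binaryValue, hv]
    rcases Nat.mod_two_eq_zero_or_one x with h | h <;> simp [h] <;> omega

/-- The operations of a machine whose states are binary words and natural numbers. -/
abbrev TapeOp (D : ℕ) : Type := Bool ⊕ Fin 4 ⊕ Fin D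

/-- Binary words can be extended, shortened, replaced by their parents or read as a number; each
natural number can be replaced by its `D` neighbors; the machine can be reset. -/
def tapeStep {D : ℕ} (nb : Fin D → ℕ → ℕ) : TapeOp D → List Bool ⊕ ℕ → List Bool ⊕ ℕ
  | .inl b, .inl l => .inl (b :: l)
  | .inr (.inl 0), .inl l => .inl l.tail
  | .inr (.inl 1), .inl l => .inl (wordParent l)
  | .inr (.inl 2), .inl l => .inr (binaryValue l)
  | .inr (.inl 3), _ => .inl []
  | .inr (.inr a), .inr x => .inr (nb a x)
  | _, s => s

variable {D : ℕ} (nb : Fin D → ℕ → ℕ)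

theorem run_push (l l' : List Bool) :
    run (tapeStep nb) (.inl l') (l.reverse.map .inl) = .inl (l ++ l') := by
  induction l with
  | nil => simp [run]
  | cons b l ih =>
    rw [List.reverse_cons, List.map_append, run_append, ih]
    simp [run, tapeStep]

/-- Any number below `2 ^ k` can be reached from any state in `k + 2` steps. -/
theorem exists_run_eq (k x : ℕ) (hx : x < 2 ^ k) :
    ∃ w : List (TapeOp D), w.length = k + 2 ∧ ∀ s, run (tapeStep nb) s w = .inr x := by
  obtain ⟨l, hl, hv⟩ := exists_binaryValue_eq k x hx
  -- Reset, push the `k` digits in reverse order, then read the word as a number. The initial reset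
  -- makes the start state irrelevant.
  refine ⟨[.inr (.inl 3)] ++ (l.reverse.map .inl ++ [.inr (.inl 2)]), by simp [hl], fun s => ?_⟩
  have h : run (tapeStep nb) s [.inr (.inl 3)] = .inl [] := by
    cases s <;> simp [run, tapeStep]
  rw [run_append, h, run_append, run_push, List.append_nil]
  simp [run, tapeStep, hv]

/-- A finite suffix-closed set of binary words is covered by a short word of operations. -/
theorem exists_word_visits_words (S : Finset (List Bool))
    (hS : ∀ b l, b :: l ∈ S → l ∈ S) :
    ∃ w : List (TapeOp D), w.length ≤ 2 * S.card ∧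
      ∀ l ∈ S, Visits (tapeStep nb) (.inl []) w (.inl l) := by
  classical
  rcases S.eq_empty_or_nonempty with rfl | ⟨l₀, hl₀⟩
  · exact ⟨[], by simp, by simp⟩
  have hnil : [] ∈ S := by
    induction l₀ with
    | nil => exact hl₀
    | cons b l ih => exact ih (hS b l hl₀)
  have hword := exists_word_visits (tapeStep nb) (.inl [])
      (S.map ⟨Sum.inl, Sum.inl_injective⟩) (by simpa using hnil) fun T hT hr => by
    obtain ⟨z, hzS, hzT⟩ := Finset.exists_of_ssubset hT
    obtain ⟨l, hl, rfl⟩ := Finset.mem_map.1 hzS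
    simp only [Function.Embedding.coeFn_mk] at hzT
    clear hl₀ hzS
    -- Shorten a missing word until its tail is in `T`, which happens at the latest at the empty
    -- word; pushing a letter is then undone by popping it.
    induction l with
    | nil => exact absurd hr hzT
    | cons b l ih =>
      by_cases hlT : Sum.inl l ∈ T
      · exact ⟨.inl l, hlT, .inl (b :: l), by simpa using hl, hzT, .inl b, .inr (.inl 0),
          by simp [tapeStep], by simp [tapeStep]⟩
      · exact ih (hS b l hl) hlT
  obtain ⟨w, hw, hvis⟩ := hword
  exact ⟨w, by simpa using hw, fun l hl => hvis _ (by simpa using hl)⟩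

end Tape

/-! ### Finite subgraphs form a tiny class -/

section Subgraphs

/-- The class of finite subgraphs of a graph. -/
def subgraphClass (𝒢 : SimpleGraph ℕ) : GraphClass where
  carrier := {H | H.2.IsContained 𝒢}
  iso_closed := fun _ _ ⟨e⟩ h => e.symm.isContained.trans h

theorem subgraphClass_isMonotone (𝒢 : SimpleGraph ℕ) : (subgraphClass 𝒢).IsMonotone :=
  fun _ hG _ hH => hH.trans hG

theorem GraphClass.IsMonotone.hereditary {C : GraphClass} (hC : C.IsMonotone) : C.Hereditary :=
  fun G hG H ⟨e⟩ => hC G hG H ⟨e.toCopy⟩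

/-- Used to charge the address of a vertex on a cycle, whose bit length is bounded through the cycle
length, to the size of the component. -/
theorem IsCycle.length_le_card {V : Type*} {G : SimpleGraph V} {x : V} {p : G.Walk x x}
    (hp : p.IsCycle) {D : Finset V} (hD : ∀ y, G.Reachable x y → y ∈ D) : p.length ≤ D.card := by
  classical
  have h1 : p.support.tail.length = p.length := by simp
  rw [← h1, ← List.toFinset_card_of_nodup hp.support_nodup]
  apply Finset.card_le_card
  intro y hy
  exact hD y ⟨p.takeUntil y (List.mem_of_mem_tail (List.mem_toFinset.1 hy))⟩

variable {D : ℕ} {nb : Fin D → ℕ → ℕ} {𝒢 : SimpleGraph ℕ}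

/-- A connected component is covered by a short word started at one of its vertices. -/
theorem exists_word_visits_component (hnb : ∀ x y, 𝒢.Adj x y → ∃ a, nb a x = y) {n : ℕ}
    {H : SimpleGraph (Fin n)} {φ : Fin n → ℕ}
    (hφ : Function.Injective φ) (hadj : ∀ u v, H.Adj u v → 𝒢.Adj (φ u) (φ v)) (y : Fin n)
    (C : Finset (Fin n)) (hC : ∀ u, u ∈ C ↔ H.Reachable y u) :
    ∃ w : List (TapeOp D), w.length ≤ 2 * C.card ∧
      ∀ u ∈ C, Visits (tapeStep nb) (.inr (φ y)) w (.inr (φ u)) := by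
  classical
  let ψ : Fin n ↪ List Bool ⊕ ℕ := ⟨fun u => .inr (φ u), Sum.inr_injective.comp hφ⟩
  have hstep : ∀ u v, H.Adj u v → ∃ a, tapeStep nb a (ψ u) = ψ v := by
    intro u v h
    obtain ⟨a, ha⟩ := hnb _ _ (hadj u v h)
    exact ⟨.inr (.inr a), by simp [ψ, tapeStep, ha]⟩
  have hword := exists_word_visits (tapeStep nb) (ψ y) (C.map ψ)
      (Finset.mem_map_of_mem _ ((hC y).2 (Reachable.refl y))) fun T hT hr => by
    obtain ⟨z, hzS, hzT⟩ := Finset.exists_of_ssubset hT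
    obtain ⟨u, hu, rfl⟩ := Finset.mem_map.1 hzS
    obtain ⟨p⟩ := (hC u).1 hu
    -- A walk from `y` to an unvisited vertex leaves the visited set along some edge, and that edge
    -- can be traversed both ways.
    obtain ⟨d, -, hd1, hd2⟩ := p.exists_boundary_dart {x | ψ x ∈ T} hr hzT
    have hfst : d.fst ∈ C := (Finset.mem_map' ψ).1 (hT.1 hd1)
    have hsnd : d.snd ∈ C := (hC _).2 (((hC _).1 hfst).trans d.adj.reachable)
    obtain ⟨a, ha⟩ := hstep _ _ d.adj
    obtain ⟨b, hb⟩ := hstep _ _ d.adj.symm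
    exact ⟨ψ d.fst, hd1, ψ d.snd, Finset.mem_map_of_mem _ hsnd, hd2, a, b, ha, hb⟩
  obtain ⟨w, hw, hvis⟩ := hword
  exact ⟨w, by simpa using hw, fun u hu => hvis _ (Finset.mem_map_of_mem _ hu)⟩

/-- A union of components that all contain cycles is covered by a short word. -/
theorem exists_word_visits_cyclic (hnb : ∀ x y, 𝒢.Adj x y → ∃ a, nb a x = y) {k : ℕ}
    (hcyc : ∀ x, ∀ p : 𝒢.Walk x x, p.IsCycle → x < 2 ^ (k * p.length)) {n : ℕ}
    {H : SimpleGraph (Fin n)} {φ : Fin n → ℕ}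
    (hφ : Function.Injective φ) (hadj : ∀ u v, H.Adj u v → 𝒢.Adj (φ u) (φ v)) :
    ∀ m, ∀ Y : Finset (Fin n), Y.card = m → (∀ u ∈ Y, ∀ v, H.Reachable u v → v ∈ Y) →
      (∀ u ∈ Y, ∃ y, H.Reachable u y ∧ ∃ p : H.Walk y y, p.IsCycle) →
      ∃ w : List (TapeOp D), w.length ≤ (k + 4) * Y.card ∧
        ∀ s, ∀ u ∈ Y, Visits (tapeStep nb) s w (.inr (φ u)) := by
  classical
  intro m
  induction m using Nat.strong_induction_on with
  | _ m ih =>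
  intro Y hYm hclosed hY
  rcases Y.eq_empty_or_nonempty with rfl | ⟨u₀, hu₀⟩
  · exact ⟨[], by simp, by simp⟩
  obtain ⟨y, hu₀y, p, hp⟩ := hY u₀ hu₀
  have hyY : y ∈ Y := hclosed u₀ hu₀ y hu₀y
  let C : Finset (Fin n) := Finset.univ.filter fun u => H.Reachable y u
  have hC : ∀ u, u ∈ C ↔ H.Reachable y u := by simp [C]
  have hCY : C ⊆ Y := fun u hu => hclosed y hyY u ((hC u).1 hu)
  have hCpos : 0 < C.card := Finset.card_pos.2 ⟨y, (hC y).2 (Reachable.refl y)⟩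
  have hcard : (Y \ C).card + C.card = Y.card := Finset.card_sdiff_add_card_eq_card hCY
  obtain ⟨w, hw, hvis⟩ := ih (Y \ C).card (by omega) (Y \ C) rfl
    (by
      intro u hu v huv
      rw [Finset.mem_sdiff, hC] at hu ⊢
      exact ⟨hclosed u hu.1 v huv, fun h => hu.2 (h.trans huv.symm)⟩)
    (fun u hu => hY u (Finset.mem_sdiff.1 hu).1)
  obtain ⟨w', hw', hvis'⟩ := exists_word_visits_component hnb hφ hadj y C hC
  let F : H →g 𝒢 := ⟨φ, fun h => hadj _ _ h⟩
  have hlt := hcyc _ (p.map F) (hp.map hφ)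
  rw [Walk.length_map] at hlt
  -- Jump to the vertex `y`, chosen on a cycle so that its label has at most `k * C.card` bits.
  obtain ⟨w₀, hw₀, hrun⟩ := exists_run_eq nb (k * C.card) (φ y)
    (hlt.trans_le (Nat.pow_le_pow_right (by norm_num)
      (Nat.mul_le_mul_left _ (IsCycle.length_le_card hp fun u hu => (hC u).2 hu))))
  refine ⟨w₀ ++ (w' ++ w), ?_, fun s u hu => ?_⟩
  · rw [List.length_append, List.length_append, ← hcard, hw₀]
    -- The component costs `k * C.card + 2` for the jump and `2 * C.card` for the tour, at most `(k
    -- + 4) * C.card` as `C` is nonempty.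
    nlinarith
  · refine Visits.append_left _ ?_
    rw [hrun]
    by_cases huC : u ∈ C
    · exact (hvis' u huC).append_right _
    · exact Visits.append_left _ (hvis _ u (Finset.mem_sdiff.2 ⟨hu, huC⟩))

/-- In a graph of bounded degree whose vertices on short cycles have small labels, every finite
subgraph is drawn by a word of linear length. -/
theorem drawn_of_isContained (hnb : ∀ x y, 𝒢.Adj x y → ∃ a, nb a x = y) {k : ℕ}
    (hcyc : ∀ x, ∀ p : 𝒢.Walk x x, p.IsCycle → x < 2 ^ (k * p.length)) {n : ℕ}
    {H : SimpleGraph (Fin n)} (hH : H.IsContained 𝒢) :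
    Drawn (tapeStep nb) (.inl []) ((k + 6) * n) H := by
  classical
  obtain ⟨F⟩ := hH
  have hφ : Function.Injective (F.toHom : Fin n → ℕ) := F.injective'
  have hadj : ∀ u v, H.Adj u v → 𝒢.Adj (F.toHom u) (F.toHom v) := fun u v h => F.toHom.map_adj h
  generalize (F.toHom : Fin n → ℕ) = φ at hφ hadj
  let Y : Finset (Fin n) :=
    Finset.univ.filter fun u => ∃ y, H.Reachable u y ∧ ∃ p : H.Walk y y, p.IsCycle
  have hY : ∀ u, u ∈ Y ↔ ∃ y, H.Reachable u y ∧ ∃ p : H.Walk y y, p.IsCycle := by simp [Y]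
  have hclosed : ∀ u ∈ Y, ∀ v, H.Reachable u v → v ∈ Y := by
    intro u hu v huv
    obtain ⟨y, hy, h⟩ := (hY u).1 hu
    exact (hY v).2 ⟨y, huv.symm.trans hy, h⟩
  obtain ⟨w₂, hw₂, hvis₂⟩ := exists_word_visits_cyclic hnb hcyc hφ hadj _ Y rfl hclosed
    fun u hu => (hY u).1 hu
  have hacyc : (H.induce {u | u ∉ Y}).IsAcyclic := by
    rintro ⟨x, hx⟩ p hp
    exact hx ((hY x).2 ⟨x, Reachable.refl x, p.map (Embedding.induce _).toHom,
      hp.map (Embedding.induce (G := H) {u | u ∉ Y}).injective⟩)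
  obtain ⟨f, hf, hsuf, hfadj⟩ := exists_forest_embedding hacyc
  obtain ⟨w₁, hw₁, hvis₁⟩ := exists_word_visits_words nb (Finset.univ.image f)
    (by simpa using hsuf)
  have hcard₁ : (Finset.univ.image f).card ≤ n := by
    refine Finset.card_image_le.trans ?_
    rw [Finset.card_univ]
    exact (Fintype.card_subtype_le (· ∈ {u | u ∉ Y})).trans (by simp)
  have hcard₂ : Y.card ≤ n := by simpa using Finset.card_le_univ Y
  -- Cyclic components stay where they lie in `𝒢`. Tree components, whose labels there may be
  -- arbitrarily large, are redrawn as words; their part of the run comes first because it starts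
  -- from the empty word.
  let ψ : Fin n → List Bool ⊕ ℕ := fun u => if h : u ∈ Y then .inr (φ u) else .inl (f ⟨u, h⟩)
  have hψY : ∀ u, u ∈ Y → ψ u = .inr (φ u) := fun u h => by simp [ψ, h]
  have hψX : ∀ u (h : u ∉ Y), ψ u = .inl (f ⟨u, h⟩) := fun u h => by simp [ψ, h]
  refine ⟨ψ, ?_, ⟨w₁ ++ w₂, ?_, ?_⟩, ?_⟩
  · intro u v huv
    by_cases hu : u ∈ Y <;> by_cases hv : v ∈ Y
    · rw [hψY u hu, hψY v hv, Sum.inr.injEq] at huv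
      exact hφ huv
    · simp [hψY u hu, hψX v hv] at huv
    · simp [hψX u hu, hψY v hv] at huv
    · rw [hψX u hu, hψX v hv, Sum.inl.injEq] at huv
      exact congrArg Subtype.val (hf huv)
  · rw [List.length_append]
    calc _ ≤ 2 * n + (k + 4) * n :=
          add_le_add (hw₁.trans (Nat.mul_le_mul_left _ hcard₁))
            (hw₂.trans (Nat.mul_le_mul_left _ hcard₂))
      _ = _ := by ring
  · intro u
    by_cases hu : u ∈ Y
    · rw [hψY u hu]
      exact Visits.append_left _ (hvis₂ _ u hu)
    · rw [hψX u hu]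
      exact (hvis₁ _ (by simp)).append_right _
  · intro u v huv
    by_cases hu : u ∈ Y
    · have hv := hclosed u hu v huv.reachable
      obtain ⟨a, ha⟩ := hnb _ _ (hadj u v huv)
      exact Or.inl ⟨.inr (.inr a), by rw [hψY u hu, hψY v hv]; simp [tapeStep, ha]⟩
    · have hv : v ∉ Y := fun hv => hu (hclosed v hv u huv.symm.reachable)
      rcases hfadj ⟨u, hu⟩ ⟨v, hv⟩ (by simpa using huv) with h | h
      · exact Or.inl ⟨.inr (.inl 1), by rw [hψX u hu, hψX v hv]; simp [tapeStep, h]⟩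
      · exact Or.inr ⟨.inr (.inl 1), by rw [hψX u hu, hψX v hv]; simp [tapeStep, h]⟩

/-- The finite subgraphs of a graph of bounded degree whose vertices on short cycles have small
labels form a tiny class. -/
theorem subgraphClass_isTiny (D k : ℕ) (𝒢 : SimpleGraph ℕ)
    (hD : ∀ x, (𝒢.neighborSet x).Finite ∧ (𝒢.neighborSet x).ncard ≤ D)
    (hcyc : ∀ x, ∀ p : 𝒢.Walk x x, p.IsCycle → x < 2 ^ (k * p.length)) :
    (subgraphClass 𝒢).IsTiny := by
  classical
  have hports : ∀ x, ∃ e : Fin D → ℕ, ∀ y, 𝒢.Adj x y → ∃ a, e a = y := by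
    intro x
    obtain ⟨hfin, hcard⟩ := hD x
    have hc : hfin.toFinset.card ≤ D := by rwa [← Set.ncard_eq_toFinset_card _ hfin]
    -- Unused ports lead to `0`. This is harmless: a drawing needs every edge to be an operation,
    -- not every operation to be an edge.
    refine ⟨fun a => if h : (a : ℕ) < hfin.toFinset.card then
      (hfin.toFinset.equivFin.symm ⟨a, h⟩ : ℕ) else 0, fun y hy => ?_⟩
    have hy' : y ∈ hfin.toFinset := by simpa using hy
    refine ⟨⟨hfin.toFinset.equivFin ⟨y, hy'⟩, (Fin.is_lt _).trans_le hc⟩, ?_⟩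
    simp
  choose nb hnb using hports
  refine ⟨(subgraphClass_isMonotone 𝒢).hereditary, ?_⟩
  set B := Fintype.card (TapeOp D) * (2 * 2 ^ Fintype.card (TapeOp D)) with hB
  have hB1 : 1 ≤ B := Nat.mul_pos Fintype.card_pos (by positivity)
  refine ⟨((B ^ (k + 7) : ℕ) : ℝ), fun n => ?_⟩
  -- The exponent `(k + 6) * n + 1` is absorbed into `(k + 7) * n` only for `n ≥ 1`.
  rcases Nat.eq_zero_or_pos n with rfl | hn
  · rw [pow_zero]
    have : Subsingleton (SimpleGraph (Fin 0)) :=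
      ⟨fun G G' => by ext x; exact x.elim0⟩
    have h2 : ((subgraphClass 𝒢).level 0).ncard ≤ 1 :=
      (Set.ncard_le_one (Set.toFinite _)).2 fun _ _ _ _ => Subsingleton.elim _ _
    exact_mod_cast (Set.ncard_image_le (Set.toFinite _)).trans h2
  · have h1 : (subgraphClass 𝒢).unlabeledCount n ≤ B ^ ((k + 6) * n + 1) := by
      refine le_trans (Set.ncard_le_ncard (Set.image_mono ?_) ((Set.toFinite _).image _))
        (ncard_drawn_le (tapeStep fun a x => nb x a) (.inl []) ((k + 6) * n) n)
      intro H hH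
      exact drawn_of_isContained (fun x y h => hnb x y h) hcyc hH
    have h2 : B ^ ((k + 6) * n + 1) ≤ (B ^ (k + 7)) ^ n := by
      rw [← pow_mul]
      exact Nat.pow_le_pow_right hB1 (by nlinarith)
    exact_mod_cast h1.trans h2

end Subgraphs

/-! ### Tiny classes are small -/

section Small

/-- A tiny class is small. -/
theorem GraphClass.IsTiny.isSmall {C : GraphClass} (hC : C.IsTiny) : C.IsSmall := by
  classical
  obtain ⟨hher, c, hc⟩ := hC
  refine ⟨hher, c, fun n => ?_⟩
  have h1 : C.labeledCount n ≤ n.factorial * C.unlabeledCount n := by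
    -- Every labeled graph is the image of the chosen representative of its isomorphism class under
    -- one of the `n!` permutations.
    have hsub : C.level n ⊆ (fun z : Equiv.Perm (Fin n) × Quotient (isoSetoid n) =>
        z.2.out.map z.1.toEmbedding) ''
          (Set.univ ×ˢ (Quotient.mk (isoSetoid n) '' C.level n)) := by
      intro G hG
      obtain ⟨e⟩ : Nonempty ((Quotient.mk (isoSetoid n) G).out ≃g G) :=
        Quotient.exact (Quotient.out_eq (Quotient.mk (isoSetoid n) G))
      refine ⟨(e.toEquiv, Quotient.mk (isoSetoid n) G), ⟨Set.mem_univ _, G, hG, rfl⟩, ?_⟩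
      ext u v
      simp only [map_adj]
      constructor
      · rintro ⟨a, b, hab, rfl, rfl⟩
        exact e.map_adj_iff.2 hab
      · intro h
        exact ⟨e.symm u, e.symm v, e.symm.map_adj_iff.2 h, e.apply_symm_apply u,
          e.apply_symm_apply v⟩
    refine (Set.ncard_le_ncard hsub (Set.toFinite _)).trans
      ((Set.ncard_image_le (Set.toFinite _)).trans ?_)
    rw [Set.ncard_prod, Set.ncard_univ, Nat.card_perm, Nat.card_eq_fintype_card, Fintype.card_fin]
    rfl
  calc (C.labeledCount n : ℝ) ≤ n.factorial * C.unlabeledCount n := by exact_mod_cast h1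
    _ ≤ _ := by gcongr; exact hc n

end Small

/-! ### Disjoint unions of the chosen graphs -/

section DisjointUnion

variable {N : ℕ → ℕ} (G : ∀ i, SimpleGraph (Fin (N i)))

/-- The disjoint union of a sequence of finite graphs, on the natural numbers. -/
def disjointUnion : SimpleGraph ℕ where
  Adj x y := ∃ i, ∃ u v : Fin (N i), (G i).Adj u v ∧ x = Nat.pair i u ∧ y = Nat.pair i v
  symm := ⟨by
    rintro x y ⟨i, u, v, h, hx, hy⟩
    exact ⟨i, v, u, h.symm, hy, hx⟩⟩
  loopless := ⟨by
    rintro x ⟨i, u, v, h, rfl, hy⟩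
    rw [Nat.pair_eq_pair] at hy
    exact h.ne (Fin.ext hy.2)⟩

variable {G}

theorem disjointUnion_adj_pair {i : ℕ} {u : Fin (N i)} {y : ℕ} :
    (disjointUnion G).Adj (Nat.pair i u) y ↔ ∃ v, (G i).Adj u v ∧ y = Nat.pair i v := by
  constructor
  · rintro ⟨j, u', v, h, hx, rfl⟩
    rw [Nat.pair_eq_pair] at hx
    obtain ⟨rfl, hu⟩ := hx
    obtain rfl := Fin.ext hu
    exact ⟨v, h, rfl⟩
  · rintro ⟨v, h, rfl⟩
    exact ⟨i, u, v, h, rfl, rfl⟩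

theorem isContained_disjointUnion (i : ℕ) : (G i).IsContained (disjointUnion G) := by
  refine ⟨⟨⟨fun u => Nat.pair i u, fun {u v} h => ⟨i, u, v, h, rfl, rfl⟩⟩, fun u v h => ?_⟩⟩
  have h' : Nat.pair i u = Nat.pair i v := h
  rw [Nat.pair_eq_pair] at h'
  exact Fin.ext h'.2

theorem disjointUnion_neighborSet {D : ℕ} (hD : ∀ i x, ((G i).neighborSet x).ncard ≤ D) (x : ℕ) :
    ((disjointUnion G).neighborSet x).Finite ∧ ((disjointUnion G).neighborSet x).ncard ≤ D := by
  by_cases hx : ∃ i, ∃ u : Fin (N i), x = Nat.pair i u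
  · obtain ⟨i, u, rfl⟩ := hx
    have h : (disjointUnion G).neighborSet (Nat.pair i u) =
        (fun v : Fin (N i) => Nat.pair i v) '' (G i).neighborSet u := by
      ext y
      simp only [mem_neighborSet, disjointUnion_adj_pair, Set.mem_image, eq_comm]
    rw [h]
    exact ⟨Set.toFinite _, (Set.ncard_image_le (Set.toFinite _)).trans (hD i u)⟩
  · have h : (disjointUnion G).neighborSet x = ∅ := by
      ext y
      simp only [mem_neighborSet, Set.mem_empty_iff_false, iff_false]
      rintro ⟨i, u, v, -, hxu, -⟩
      exact hx ⟨i, u, hxu⟩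
    simp [h]

theorem disjointUnion_mem_support {i : ℕ} {x y : ℕ} (p : (disjointUnion G).Walk x y)
    (hx : ∃ u : Fin (N i), x = Nat.pair i u) :
    ∀ z ∈ p.support, ∃ u : Fin (N i), z = Nat.pair i u := by
  induction p with
  | nil => simpa using hx
  | cons h p ih =>
    intro z hz
    rw [Walk.support_cons, List.mem_cons] at hz
    rcases hz with rfl | hz
    · exact hx
    · obtain ⟨u, rfl⟩ := hx
      obtain ⟨v, -, hv⟩ := disjointUnion_adj_pair.1 h
      exact ih ⟨v, hv⟩ z hz

/-- A walk never leaves its block, and a cycle has an edge, so it does not sit at one of the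
isolated numbers outside all blocks. Restricting to the block and projecting to `G i` is injective
and preserves the length. -/
theorem exists_isCycle_of_disjointUnion {x : ℕ} (p : (disjointUnion G).Walk x x)
    (hp : p.IsCycle) : ∃ i, ∃ u : Fin (N i), x = Nat.pair i u ∧
      ∃ q : (G i).Walk u u, q.IsCycle ∧ q.length = p.length := by
  classical
  obtain ⟨i, u, v, -, hxu, -⟩ := p.adj_snd hp.not_nil
  let s : Set ℕ := {z | ∃ u : Fin (N i), z = Nat.pair i u}
  have hs : ∀ z ∈ p.support, z ∈ s := disjointUnion_mem_support p ⟨u, hxu⟩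
  have hcyc : (p.induce s hs).IsCycle := by
    apply Walk.IsCycle.of_map (f := (Embedding.induce s).toHom)
    rwa [Walk.map_induce]
  choose ρ hρ using fun z : s => z.2
  let F : (disjointUnion G).induce s →g G i := ⟨ρ, by
    intro a b hab
    rw [induce_adj, hρ a, hρ b, disjointUnion_adj_pair] at hab
    obtain ⟨v, hv, hbv⟩ := hab
    rw [Nat.pair_eq_pair] at hbv
    rwa [Fin.ext hbv.2]⟩
  have hF : Function.Injective F := by
    intro a b hab
    have hab' : ρ a = ρ b := hab
    exact Subtype.ext (by rw [hρ a, hρ b, hab'])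
  refine ⟨i, _, hρ ⟨x, hs x p.start_mem_support⟩, (p.induce s hs).map F, hcyc.map hF, ?_⟩
  rw [Walk.length_map, ← Walk.length_map (Embedding.induce s).toHom, Walk.map_induce]
  rfl

/-- Disjoint unions of graphs of bounded degree and logarithmic girth have a tiny class of
subgraphs. -/
theorem subgraphClass_disjointUnion_isTiny {D k : ℕ} (hN : ∀ i, i ≤ N i)
    (hD : ∀ i x, ((G i).neighborSet x).ncard ≤ D)
    (hcyc : ∀ i x, ∀ p : (G i).Walk x x, p.IsCycle → N i < 2 ^ (k * p.length)) :
    (subgraphClass (disjointUnion G)).IsTiny := by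
  -- The pairing function at most squares the size `N i + 1`, doubling the bits; `i ≤ N i` is what
  -- keeps the block index as cheap as the vertex.
  refine subgraphClass_isTiny D (k * 2) _ (disjointUnion_neighborSet hD) fun x p hp => ?_
  obtain ⟨i, u, rfl, q, hq, hlen⟩ := exists_isCycle_of_disjointUnion p hp
  have h1 := hcyc i u q hq
  calc Nat.pair i u < (max i u + 1) ^ 2 := Nat.pair_lt_max_add_one_sq _ _
    _ ≤ (2 ^ (k * q.length)) ^ 2 := by
        have := hN i
        have := u.2
        gcongr
        omega
    _ = 2 ^ (k * 2 * p.length) := by rw [← pow_mul, hlen]; ring_nf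

end DisjointUnion

/-! ### Diagonalization over parameters and bounds -/

/-- Countably many `c`-factorial parameters are simultaneously unbounded on some monotone tiny
class. -/
theorem exists_monotone_tiny_unbounded (c : ℝ) (S : Set GraphParameter) (hS : S.Countable)
    (hfac : ∀ σ ∈ S, σ.IsFactorial c) :
    ∃ C : GraphClass, C.IsMonotone ∧ C.IsTiny ∧ ∀ σ ∈ S, ¬ σ.BoundedOn C := by
  obtain ⟨D, k, hev⟩ := exists_degree_girth_count c
  have := hS.toEncodable
  -- The index `i` encodes a parameter together with a bound `κ`; if it encodes no parameter, any
  -- graph of the family serves.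
  have hex : ∀ i : ℕ, ∃ N, i ≤ N ∧ ∃ G : SimpleGraph (Fin N),
      (∀ x, (G.neighborSet x).ncard ≤ D) ∧
      (∀ x, ∀ p : G.Walk x x, p.IsCycle → N < 2 ^ (k * p.length)) ∧
      ∀ σ : S, Encodable.decode (α := S) i.unpair.1 = some σ →
        (i.unpair.2 : ℝ) < σ.1.toFun ⟨N, G⟩ := by
    intro i
    rcases hσ : Encodable.decode (α := S) i.unpair.1 with _ | σ
    · obtain ⟨N, ⟨F, hF, hFG⟩, hN⟩ := (hev.and (Filter.eventually_ge_atTop i)).exists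
      have hne : F.ncard ≠ 0 := by
        rintro h
        rw [h, Nat.cast_zero] at hF
        exact absurd hF (not_lt.2 (Real.rpow_nonneg (Nat.cast_nonneg _) _))
      obtain ⟨G, hG⟩ := Set.nonempty_of_ncard_ne_zero hne
      exact ⟨N, hN, G, (hFG G hG).1, (hFG G hG).2, by simp⟩
    · have hcount := ((hfac σ.1 σ.2).1 i.unpair.2).2
      obtain ⟨N, ⟨⟨F, hF, hFG⟩, hN⟩, hle⟩ :=
        ((hev.and (Filter.eventually_ge_atTop i)).and hcount).exists
      have hlt : ((σ.1.sublevel i.unpair.2).level N).ncard < F.ncard := by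
        exact_mod_cast hle.trans_lt hF
      obtain ⟨G, hG, hGn⟩ := Set.exists_mem_notMem_of_ncard_lt_ncard hlt (Set.toFinite _)
      refine ⟨N, hN, G, (hFG G hG).1, (hFG G hG).2, ?_⟩
      intro σ' h
      obtain rfl := Option.some.inj h
      exact not_le.1 hGn
  choose N hN G hD hcyc hG using hex
  refine ⟨subgraphClass (disjointUnion G), subgraphClass_isMonotone _,
    subgraphClass_disjointUnion_isTiny hN hD hcyc, ?_⟩
  rintro σ hσ ⟨κ, hκ⟩
  have h := hG (Nat.pair (Encodable.encode (⟨σ, hσ⟩ : S)) κ) ⟨σ, hσ⟩ (by simp)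
  rw [Nat.unpair_pair] at h
  exact absurd (hκ _ (isContained_disjointUnion _)) (not_le.2 h)

end TinyClasses

theorem corollary4p3 (c : ℝ) (hc : 0 < c) (S : Set TinyClasses.GraphParameter)
    (hS : S.Countable) (hfac : ∀ σ ∈ S, σ.IsFactorial c) :
    (∃ C : TinyClasses.GraphClass,
        C.IsMonotone ∧ C.IsTiny ∧ ∀ σ ∈ S, ¬ σ.BoundedOn C) ∧
      ¬ TinyClasses.Describes S {C | C.IsMonotone ∧ C.IsTiny} ∧
      ¬ TinyClasses.Describes S {C | C.IsSmall} := by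
  obtain ⟨C, hmono, htiny, hunb⟩ := TinyClasses.exists_monotone_tiny_unbounded c S hS hfac
  refine ⟨⟨C, hmono, htiny, hunb⟩, fun h => ?_, fun h => ?_⟩
  · obtain ⟨σ, hσ, hb⟩ := h C ⟨hmono, htiny⟩
    exact hunb σ hσ hb
  · obtain ⟨σ, hσ, hb⟩ := h C htiny.isSmall
    exact hunb σ hσ hb
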